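/- Let $\Omega\subset\mathbb{R}^3$ be a bounded open set with diameter $D=\operatorname{diam}(\Omega)$ (no regularity of the boundary is needed; in particular $\Omega$ may be a bounded convex domain with $C^1$-boundary and strictly positive curvature). Let $\{\varphi_j\}_{j\in\mathbb{N}}\subset C(\mathbb{S}^2,L^\infty(\Omega))$ be a sequence of real-valued functions $\varphi_j(x,n)$ such that $\sup_{j}\sup_{n\in\mathbb{S}^2}\|\varphi_j(\cdot,n)\|_{L^\infty(\Omega)}<\infty$ and $$\|\varphi_j(\cdot,n_1)-\varphi_j(\cdot,n_2)\|_{L^\infty(\Omega)}\le\sigma(d(n_1,n_2))\qquad\text{for all } j\in\mathbb{N},\ n_1,n_2\in\mathbb{S}^2,$$ where $d$ is the geodesic distance on $\mathbb{S}^2$ and $\sigma:[0,\infty)\to[0,\infty)$ is a continuous function with $\sigma(0)=0$. Let $\{\psi_j\}_{j\in\mathbb{N}}$ be a bounded sequence of real-valued functions in $L^\infty(\Omega)$. Extend $\varphi_j(\cdot,n)$ and $\psi_j$ by zero outside $\Omega$. Then every $\varphi_j$ has a version that is jointly measurable in $(x,n)$ (and represents the class $\varphi_j(\cdot,n)$ for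 every $n\in\mathbb{S}^2$); and, for any choice of such versions, the integrals in $$u_j(x)=\int_{\mathbb{S}^2}\int_0^D\varphi_j(x-rn,n)\exp\left(-\int_0^r\psi_j(x-\lambda n)\,d\lambda\right)dr\,dn$$ (with $dn$ the surface measure of $\mathbb{S}^2$) converge absolutely for almost every $x\in\Omega$, $u_j\in L^2(\Omega)$ for every $j$, and the set $\{u_j: j\in\mathbb{N}\}$ is relatively compact in $L^2(\Omega)$. -/

import Mathlib

open MeasureTheory
open scoped ENNReal

/-- Three-dimensional Euclidean space. -/
abbrev Space3 : Type := EuclideanSpace ℝ (Fin 3)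

/-- The unit sphere of directions in three-dimensional Euclidean space. -/
abbrev Sphere2 : Type := Metric.sphere (0 : Space3) 1

/-- The surface measure on the unit sphere (of total mass `4 π`). -/
noncomputable abbrev surfaceMeasure : Measure Sphere2 :=
  (volume : Measure Space3).toSphere

/-- `L^p(Ω)`: real-valued `L^p` classes with respect to Lebesgue measure on `Ω`. -/
noncomputable abbrev LpOn (p : ℝ≥0∞) (Ω : Set Space3) : Type :=
  Lp ℝ p (volume.restrict Ω)

/-- `f(x, n)` is a jointly Borel measurable version of the continuous `L^∞(Ω)`-valued map `Φ` on
the sphere: for every direction `n`, the function `f(·, n)` represents the class `Φ n`.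
A version is needed to give a meaning to pointwise expressions such as `Φ(x - r n, n)`. -/
def IsMeasurableVersion (Ω : Set Space3) (Φ : C(Sphere2, LpOn ∞ Ω))
    (f : Space3 → Sphere2 → ℝ) : Prop :=
  Measurable (fun p : Space3 × Sphere2 => f p.1 p.2) ∧
    ∀ n : Sphere2, (fun x => f x n) =ᵐ[volume.restrict Ω] Φ n

/-- The integrand `f(x - r n, n) exp(-∫_0^r g(x - l n) dl)`, where `f(·, n)` and `g` are extended
by zero outside `Ω`. -/
noncomputable def attenuatedIntegrand (Ω : Set Space3) (f : Space3 → Sphere2 → ℝ)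
    (g : Space3 → ℝ) (x : Space3) (n : Sphere2) (r : ℝ) : ℝ :=
  Ω.indicator (fun y => f y n) (x - r • (n : Space3)) *
    Real.exp (-∫ l in (0 : ℝ)..r, Ω.indicator g (x - l • (n : Space3)))

/-- The function `x ↦ ∫_{S²} ∫_0^D f(x - r n, n) exp(-∫_0^r g(x - l n) dl) dr dn`, where
`D` is the diameter of `Ω`, and `f(·, n)` and `g` are extended by zero outside `Ω`. -/
noncomputable def attenuatedLineIntegral (Ω : Set Space3) (f : Space3 → Sphere2 → ℝ)
    (g : Space3 → ℝ) (x : Space3) : ℝ :=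
  ∫ n : Sphere2, (∫ r in (0 : ℝ)..(Metric.diam Ω), attenuatedIntegrand Ω f g x n r)
    ∂surfaceMeasure

/-- All the integrals occurring in `attenuatedLineIntegral Ω f g x` converge absolutely. -/
def AttenuatedIntegrable (Ω : Set Space3) (f : Space3 → Sphere2 → ℝ)
    (g : Space3 → ℝ) (x : Space3) : Prop :=
  (∀ᵐ n : Sphere2 ∂surfaceMeasure,
      IntervalIntegrable (fun l : ℝ => Ω.indicator g (x - l • (n : Space3))) volume
        0 (Metric.diam Ω)) ∧
    Integrable (fun p : Sphere2 × ℝ => attenuatedIntegrand Ω f g x p.1 p.2)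
      (surfaceMeasure.prod (volume.restrict (Set.Ioc 0 (Metric.diam Ω))))

/-! By separability of `L¹`, some subsequence of the `ψ_j`, and of the `φ_j(·, e_m)` for a dense
sequence of directions `e_m`, is weakly Cauchy against every `L¹` function. Averaging over rays
turns this into strong convergence, because polar coordinates push `dn dr` forward to a measure
absolutely continuous with respect to Lebesgue measure.

Attenuation: the square of a segment integral of `h`, integrated over `x`, `n`, `r`, is a double
integral of `h(x - t n) h(x - t' n)`. A translation turns it into `∫ h(x) J(x) dx`, where `J(x)`
integrates `h` against the law of `x + (t - t') n`. That law is absolutely continuous, so `J → 0`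
pointwise when `h` is weakly null, and dominated convergence applies
(`WeaklyNull.tendsto_integral_mul_shift`, `WeaklyNull.tendsto_integral_segmentIntegral_sq`).

Source: with the attenuation frozen, the integral over rays through `x` is a weak pairing for each
fixed direction argument. The modulus `σ` allows that argument to be replaced by one of finitely
many `e_m` with an error uniform in `j` (`tendsto_integral_ray_of_approx`).

Freezing the attenuation at a late index `N` separates the two weak limits, so the subsequence of
the `u_j` is Cauchy in `L²` (`eventually_integral_sq_rayAverage_sub_lt`). Since this applies to
every reindexing of the sequence, its range is totally bounded. -/

open Set Filter Topology

/-! ### Polar coordinates and null sets along rays -/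

/-- A Lebesgue null set meets almost every open half-line from the origin in a null set. -/
theorem measure_sphere_prod_smul_preimage_eq_zero {N : Set Space3} (hN : MeasurableSet N)
    (h0 : volume N = 0) :
    ∀ᵐ n : Sphere2 ∂surfaceMeasure, volume {r : ℝ | 0 < r ∧ r • (n : Space3) ∈ N} = 0 := by
  have hmp := (volume : Measure Space3).measurePreserving_homeomorphUnitSphereProd
  have hsymm := hmp.symm (homeomorphUnitSphereProd Space3).toMeasurableEquiv
  have hS : MeasurableSet ((fun p : Sphere2 × Ioi (0 : ℝ) => p.2.1 • (p.1 : Space3)) ⁻¹' N) := by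
    apply measurableSet_preimage _ hN
    fun_prop
  have h1 : (surfaceMeasure.prod (Measure.volumeIoiPow (Module.finrank ℝ Space3 - 1)))
      ((fun p : Sphere2 × Ioi (0 : ℝ) => p.2.1 • (p.1 : Space3)) ⁻¹' N) = 0 := by
    have := hsymm.measure_preimage (s := (Subtype.val ⁻¹' N))
      (hN.preimage measurable_subtype_coe).nullMeasurableSet
    have h2 : (volume.comap (Subtype.val : ({0}ᶜ : Set Space3) → Space3))
        (Subtype.val ⁻¹' N) = 0 := by
      rw [comap_subtype_coe_apply (measurableSet_singleton _).compl]
      exact measure_mono_null (Set.image_preimage_subset _ _) h0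
    rw [h2] at this
    convert this using 2
    ext p
    exact Iff.of_eq (congrArg (· ∈ N) (homeomorphUnitSphereProd_symm_apply_coe Space3 p).symm)
  rw [Measure.measure_prod_null hS] at h1
  filter_upwards [h1] with n hn
  -- The radial measure has density `r ^ 2` with respect to Lebesgue measure; as this is positive on
  -- `(0, ∞)`, its null sets are Lebesgue null.
  have hpos : ∀ r : Ioi (0 : ℝ), ENNReal.ofReal (r.1 ^ (Module.finrank ℝ Space3 - 1)) ≠ 0 := by
    intro r
    have : 0 < r.1 := r.2
    exact (ENNReal.ofReal_pos.2 (pow_pos this _)).ne'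
  have hac := withDensity_absolutelyContinuous' (μ := Measure.comap Subtype.val volume)
    (f := fun r : Ioi (0 : ℝ) => ENNReal.ofReal (r.1 ^ (Module.finrank ℝ Space3 - 1)))
    (by fun_prop) (Eventually.of_forall hpos)
  have h3 := hac hn
  rw [comap_subtype_coe_apply measurableSet_Ioi] at h3
  refine measure_mono_null ?_ h3
  rintro r ⟨hr, hrN⟩
  exact ⟨⟨r, hr⟩, hrN, rfl⟩

/-- Polar coordinates around `a` (with radii of either sign) pull null sets back to null sets. -/
theorem quasiMeasurePreserving_sub_smul (a : Space3) :
    Measure.QuasiMeasurePreserving (fun p : Sphere2 × ℝ => a - p.2 • (p.1 : Space3))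
      (surfaceMeasure.prod volume) volume := by
  have hm : Measurable (fun p : Sphere2 × ℝ => a - p.2 • (p.1 : Space3)) := by fun_prop
  refine ⟨hm, Measure.AbsolutelyContinuous.mk fun s hs h0 => ?_⟩
  rw [Measure.map_apply hm hs, Measure.measure_prod_null (hm hs)]
  have q1 := Measure.measurePreserving_sub_left (volume : Measure Space3) a
  have q2 := (measurePreserving_add_left (volume : Measure Space3) a)
  have h1 := measure_sphere_prod_smul_preimage_eq_zero (q1.measurable hs)
    (by rw [q1.measure_preimage hs.nullMeasurableSet, h0])
  have h2 := measure_sphere_prod_smul_preimage_eq_zero (q2.measurable hs)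
    (by rw [q2.measure_preimage hs.nullMeasurableSet, h0])
  filter_upwards [h1, h2] with n hn1 hn2
  -- Negative radii reduce to positive ones: `a - r n = a + |r| n` when `r < 0`.
  have h3 : volume (Neg.neg ⁻¹' {r : ℝ | 0 < r ∧ r • (n : Space3) ∈ (fun y => a + y) ⁻¹' s}) = 0 := by
    rw [Measure.measure_preimage_neg]; exact hn2
  refine measure_mono_null ?_
    (measure_union_null (measure_union_null hn1 h3) (measure_singleton (0 : ℝ)))
  intro r hr
  rcases lt_trichotomy r 0 with h | h | h
  · left; right
    simp only [mem_preimage, mem_ofPred_eq] at hr ⊢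
    refine ⟨by linarith, ?_⟩
    simpa [sub_eq_add_neg] using hr
  · right; exact h
  · left; left; exact ⟨h, hr⟩

/-- The product of the surface measure with Lebesgue measure on `(0, R]`. -/
noncomputable def rayMeasure (R : ℝ) : Measure (Sphere2 × ℝ) :=
  surfaceMeasure.prod (volume.restrict (Ioc 0 R))

instance (R : ℝ) : IsFiniteMeasure (rayMeasure R) := by
  unfold rayMeasure; infer_instance

theorem rayMeasure_absolutelyContinuous (R : ℝ) :
    rayMeasure R ≪ surfaceMeasure.prod volume :=
  Measure.AbsolutelyContinuous.rfl.prod Measure.restrict_le_self.absolutelyContinuous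

theorem ae_rayMeasure_mem (R : ℝ) : ∀ᵐ p ∂rayMeasure R, p.2 ∈ Ioc 0 R := by
  have : Measure.QuasiMeasurePreserving Prod.snd (rayMeasure R) (volume.restrict (Ioc 0 R)) :=
    Measure.quasiMeasurePreserving_snd
  exact this.ae (ae_restrict_mem measurableSet_Ioc)

theorem quasiMeasurePreserving_ray (R : ℝ) (a : Space3) :
    Measure.QuasiMeasurePreserving (fun p : Sphere2 × ℝ => a - p.2 • (p.1 : Space3))
      (rayMeasure R) volume :=
  (quasiMeasurePreserving_sub_smul a).mono_left (rayMeasure_absolutelyContinuous R)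

/-! ### Weak convergence and extraction of subsequences -/

/-- Convergence to zero against all finite measures absolutely continuous with respect to
Lebesgue measure. -/
def WeaklyNull {ι : Type*} (l : Filter ι) (h : ι → Space3 → ℝ) : Prop :=
  ∀ μ : Measure Space3, IsFiniteMeasure μ → μ ≪ volume →
    Tendsto (fun i => ∫ y, h i y ∂μ) l (𝓝 0)

theorem exists_dense_seq_integrable : ∃ G : ℕ → Space3 → ℝ, (∀ m, Integrable (G m)) ∧
    ∀ F : Space3 → ℝ, Integrable F → ∀ ε > 0, ∃ m, ∫ y, |F y - G m y| < ε := by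
  have : Fact ((1 : ℝ≥0∞) ≠ ∞) := ⟨ENNReal.one_ne_top⟩
  have : SecondCountableTopology (Lp ℝ 1 (volume : Measure Space3)) := inferInstance
  refine ⟨fun m => TopologicalSpace.denseSeq (Lp ℝ 1 (volume : Measure Space3)) m,
    fun m => L1.integrable_coeFn _, fun F hF ε hε => ?_⟩
  obtain ⟨m, hm⟩ := (TopologicalSpace.denseRange_denseSeq
    (Lp ℝ 1 (volume : Measure Space3))).exists_dist_lt hF.toL1 hε
  refine ⟨m, lt_of_eq_of_lt ?_ hm⟩
  rw [dist_eq_norm, L1.norm_eq_integral_norm]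
  apply integral_congr_ae
  filter_upwards [Lp.coeFn_sub hF.toL1
      (TopologicalSpace.denseSeq (Lp ℝ 1 (volume : Measure Space3)) m),
    hF.coeFn_toL1] with y h1 h2
  rw [h1, Pi.sub_apply, h2, Real.norm_eq_abs]

theorem abs_integral_mul_le {G h : Space3 → ℝ} {M : ℝ} (hG : Integrable G)
    (hb : ∀ y, |h y| ≤ M) : |∫ y, G y * h y| ≤ M * ∫ y, |G y| := by
  rw [← integral_const_mul]
  rw [← Real.norm_eq_abs]
  refine norm_integral_le_of_norm_le (hG.abs.const_mul M) (Eventually.of_forall fun y => ?_)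
  rw [Real.norm_eq_abs, abs_mul, mul_comm]
  exact mul_le_mul_of_nonneg_right (hb y) (abs_nonneg _)

/-- Sequential Banach–Alaoglu, for countably many bounded sequences at once: convergence is arranged
on a countable dense set of `L¹` and extended by the uniform bound `M`. -/
theorem exists_subseq_cauchySeq_integral {h : ℕ → ℕ → Space3 → ℝ}
    (hm : ∀ k j, Measurable (h k j)) {M : ℝ} (hb : ∀ k j y, |h k j y| ≤ M) :
    ∃ s : ℕ → ℕ, StrictMono s ∧ ∀ k, ∀ F : Space3 → ℝ, Integrable F →
      CauchySeq fun j => ∫ y, F y * h k (s j) y := by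
  obtain ⟨G, hGi, hGd⟩ := exists_dense_seq_integrable
  -- Compactness of a countable product of intervals plays the role of the diagonal argument.
  have hK : IsCompact (Set.univ.pi fun q : ℕ × ℕ =>
      Icc (-(M * ∫ y, |G q.2 y|)) (M * ∫ y, |G q.2 y|)) :=
    isCompact_univ_pi fun _ => isCompact_Icc
  obtain ⟨a, -, s, hs, ha⟩ := hK.tendsto_subseq
    (x := fun j q => ∫ y, G q.2 y * h q.1 j y)
    (fun j q _ => abs_le.1 (abs_integral_mul_le (hGi _) (hb _ _)))
  refine ⟨s, hs, fun k F hF => ?_⟩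
  have hM : 0 ≤ M := (abs_nonneg _).trans (hb 0 0 0)
  have hint : ∀ {F : Space3 → ℝ}, Integrable F → ∀ j, Integrable (fun y => F y * h k (s j) y) :=
    fun hF j => hF.mul_bdd (hm _ _).aestronglyMeasurable (Eventually.of_forall fun y => hb _ _ y)
  rw [Metric.cauchySeq_iff']
  intro ε hε
  -- Replacing `F` by `G m` costs less than `ε / 4` at each of the two indices; `M + 1` avoids
  -- dividing by zero.
  obtain ⟨m, hmε⟩ := hGd F hF (ε / (4 * (M + 1))) (by positivity)
  have hc : CauchySeq fun j => ∫ y, G m y * h k (s j) y :=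
    ((tendsto_pi_nhds.1 ha (k, m))).cauchySeq
  obtain ⟨N, hN⟩ := Metric.cauchySeq_iff'.1 hc (ε / 2) (by positivity)
  refine ⟨N, fun j hj => ?_⟩
  have key : ∀ j, |(∫ y, F y * h k (s j) y) - ∫ y, G m y * h k (s j) y| < ε / 4 := by
    intro j
    rw [← integral_sub (hint hF j) (hint (hGi m) j)]
    simp_rw [← sub_mul]
    refine (abs_integral_mul_le (hF.sub (hGi m)) (hb k (s j))).trans_lt ?_
    have h1 : M * ∫ y, |(F - G m) y| ≤ (M + 1) * ∫ y, |F y - G m y| := by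
      simp only [Pi.sub_apply]
      gcongr
      linarith
    refine h1.trans_lt ?_
    calc (M + 1) * ∫ y, |F y - G m y| < (M + 1) * (ε / (4 * (M + 1))) := by gcongr
      _ = ε / 4 := by field_simp
  have h1 := hN j hj
  have h2 := key j
  have h3 := key N
  rw [Real.dist_eq] at *
  rw [abs_lt] at *
  constructor <;> linarith [h1.1, h1.2, h2.1, h2.2, h3.1, h3.2]

/-- Uniformly bounded sequences have a common subsequence that is weakly Cauchy. -/
theorem exists_subseq_weaklyNull_sub {h : ℕ → ℕ → Space3 → ℝ}
    (hm : ∀ k j, Measurable (h k j)) {M : ℝ} (hb : ∀ k j y, |h k j y| ≤ M) :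
    ∃ s : ℕ → ℕ, StrictMono s ∧ ∀ k,
      WeaklyNull atTop fun (p : ℕ × ℕ) y => h k (s p.1) y - h k (s p.2) y := by
  obtain ⟨s, hs, H⟩ := exists_subseq_cauchySeq_integral hm hb
  refine ⟨s, hs, fun k μ _ hμ => ?_⟩
  -- The `L¹` test function is the Radon–Nikodym density of `μ`.
  have hc := cauchySeq_iff_tendsto_dist_atTop_0.1
    (H k (fun y => (μ.rnDeriv volume y).toReal) Measure.integrable_toReal_rnDeriv)
  rw [tendsto_zero_iff_abs_tendsto_zero]
  refine hc.congr fun p => ?_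
  have hi : ∀ j, Integrable (h k (s j)) μ := fun j =>
    Integrable.of_bound (hm _ _).aestronglyMeasurable M (Eventually.of_forall fun y => hb _ _ y)
  simp only [Function.comp_apply]
  have hr : ∀ j, ∫ y, (μ.rnDeriv volume y).toReal * h k (s j) y = ∫ y, h k (s j) y ∂μ := fun j =>
    integral_rnDeriv_smul hμ
  rw [integral_sub (hi _) (hi _), Real.dist_eq, hr, hr]

/-! ### Quadratic averages over pairs of shifts -/

theorem integrable_prod_comp_sub {Θ : Type*} [MeasurableSpace Θ] (τ : Measure Θ)
    [IsFiniteMeasure τ] {a : Θ → Space3} (ha : Measurable a) {h : Space3 → ℝ} (hm : Measurable h)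
    (hi : Integrable h) :
    Integrable (fun q : Space3 × Θ => h (q.1 - a q.2)) (volume.prod τ) := by
  have hmeas : Measurable (fun q : Space3 × Θ => h (q.1 - a q.2)) := by fun_prop
  rw [integrable_prod_iff' hmeas.aestronglyMeasurable]
  refine ⟨Eventually.of_forall fun θ => hi.comp_sub_right (a θ), ?_⟩
  have : ∀ θ, ∫ x, ‖h (x - a θ)‖ = ∫ x, ‖h x‖ := fun θ =>
    integral_sub_right_eq_self (fun x => ‖h x‖) (a θ)
  simp only [this]
  exact integrable_const _

theorem integrable_prod_mul_shift {Θ : Type*} [MeasurableSpace Θ] (τ : Measure Θ)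
    [IsFiniteMeasure τ] {a c : Θ → Space3} (ha : Measurable a) (hc : Measurable c)
    {h : Space3 → ℝ} (hm : Measurable h) {M : ℝ} (hM : ∀ y, |h y| ≤ M) (hi : Integrable h) :
    Integrable (fun q : Space3 × Θ => h (q.1 - a q.2) * h (q.1 - c q.2)) (volume.prod τ) := by
  refine (integrable_prod_comp_sub τ ha hm hi).mul_bdd (c := M) ?_
    (Eventually.of_forall fun q => hM _)
  have : Measurable (fun q : Space3 × Θ => h (q.1 - c q.2)) := by fun_prop
  exact this.aestronglyMeasurable

/-- Quadratic averages of a bounded weakly null family tend to zero as soon as the differences of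
the two shifts are spread out over a set of positive measure. -/
theorem WeaklyNull.tendsto_integral_mul_shift {ι : Type*} {l : Filter ι} [l.IsCountablyGenerated]
    {h : ι → Space3 → ℝ} (hw : WeaklyNull l h) (hm : ∀ i, Measurable (h i)) {M : ℝ}
    (hM : ∀ i y, |h i y| ≤ M) {b : Space3 → ℝ} (hb : Integrable b) (hhb : ∀ i y, |h i y| ≤ b y)
    {Θ : Type*} [MeasurableSpace Θ] (τ : Measure Θ) [IsFiniteMeasure τ]
    {a c : Θ → Space3} (ha : Measurable a) (hc : Measurable c)
    (hac : ∀ x : Space3, Measure.QuasiMeasurePreserving (fun θ => x + a θ - c θ) τ volume) :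
    Tendsto (fun i => ∫ x, ∫ θ, h i (x - a θ) * h i (x - c θ) ∂τ) l (𝓝 0) := by
  have hi : ∀ i, Integrable (h i) := fun i =>
    hb.mono' (hm i).aestronglyMeasurable (Eventually.of_forall (hhb i))
  have e1 : ∀ i, ∫ x, ∫ θ, h i (x - a θ) * h i (x - c θ) ∂τ =
      ∫ x, h i x * ∫ θ, h i (x + a θ - c θ) ∂τ := by
    intro i
    have i1 := integrable_prod_mul_shift τ ha hc (hm i) (hM i) (hi i)
    have i2 : Integrable (fun q : Space3 × Θ => h i q.1 * h i (q.1 + a q.2 - c q.2))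
        (volume.prod τ) := by
      have := integrable_prod_comp_sub τ (a := fun _ => (0 : Space3)) measurable_const (hm i) (hi i)
      simp only [sub_zero] at this
      refine this.mul_bdd (c := M) ?_ (Eventually.of_forall fun q => hM i _)
      have : Measurable (fun q : Space3 × Θ => h i (q.1 + a q.2 - c q.2)) := by fun_prop
      exact this.aestronglyMeasurable
    rw [integral_integral_swap (f := fun x θ => h i (x - a θ) * h i (x - c θ)) i1]
    simp_rw [← integral_const_mul]
    rw [integral_integral_swap (f := fun x θ => h i x * h i (x + a θ - c θ)) i2]
    refine integral_congr_ae (Eventually.of_forall fun θ => ?_)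
    simp only
    -- For fixed `θ`, translating `x` by `a θ` removes the shift from the first factor, so only the
    -- difference of shifts remains.
    rw [← integral_add_right_eq_self (fun x => h i (x - a θ) * h i (x - c θ)) (a θ)]
    simp
  simp_rw [e1]
  have hJ : ∀ x, Tendsto (fun i => ∫ θ, h i (x + a θ - c θ) ∂τ) l (𝓝 0) := by
    intro x
    have hq := hac x
    -- The law of `x + a θ - c θ` is itself an admissible test measure, so convergence holds at
    -- every `x`.
    refine (hw (τ.map fun θ => x + a θ - c θ) inferInstance hq.absolutelyContinuous).congr fun i => ?_
    exact integral_map hq.measurable.aemeasurable (hm i).aestronglyMeasurable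
  have hJb : ∀ i x, ‖∫ θ, h i (x + a θ - c θ) ∂τ‖ ≤ M * τ.real univ := fun i x =>
    norm_integral_le_of_norm_le_const (Eventually.of_forall fun θ => hM i _)
  -- Space has infinite volume, so the constant bound `M` does not dominate; the integrable majorant
  -- `b` does.
  have := tendsto_integral_filter_of_dominated_convergence (μ := volume) (l := l)
    (F := fun i x => h i x * ∫ θ, h i (x + a θ - c θ) ∂τ) (f := fun _ => (0 : ℝ))
    (fun x => b x * (M * τ.real univ)) ?_ ?_ (hb.mul_const _) ?_
  · simpa using this
  · refine Eventually.of_forall fun i => ?_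
    refine (hm i).aestronglyMeasurable.mul ?_
    have : StronglyMeasurable (fun q : Space3 × Θ => h i (q.1 + a q.2 - c q.2)) :=
      Measurable.stronglyMeasurable (by fun_prop)
    exact this.integral_prod_right.aestronglyMeasurable
  · refine Eventually.of_forall fun i => Eventually.of_forall fun x => ?_
    rw [norm_mul]
    exact mul_le_mul (hhb i x) (hJb i x) (norm_nonneg _) ((abs_nonneg _).trans (hhb i x))
  · refine Eventually.of_forall fun x => ?_
    refine squeeze_zero_norm (a := fun i => M * |∫ θ, h i (x + a θ - c θ) ∂τ|) (fun i => ?_) ?_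
    · rw [norm_mul]
      exact mul_le_mul_of_nonneg_right (hM i x) (abs_nonneg _)
    · simpa using (hJ x).abs.const_mul M

/-! ### Segment integrals of the attenuation coefficient -/

/-- The integral of `g` over the segment of length `p.2` from `x` in the direction `-p.1`. -/
noncomputable def segmentIntegral (g : Space3 → ℝ) (x : Space3) (p : Sphere2 × ℝ) : ℝ :=
  ∫ t in Ioc 0 p.2, g (x - t • (p.1 : Space3))

/-- With a domain of integration independent of `p`, the square becomes an integral over a fixed
product space. -/
theorem segmentIntegral_eq {R : ℝ} {p : Sphere2 × ℝ} (hp : p.2 ∈ Ioc 0 R) (g : Space3 → ℝ)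
    (x : Space3) : segmentIntegral g x p =
      ∫ t in Ioc 0 R, (Iic p.2).indicator (fun t => g (x - t • (p.1 : Space3))) t := by
  rw [setIntegral_indicator measurableSet_Iic, Ioc_inter_Iic, min_eq_right hp.2, segmentIntegral]

theorem measurable_segmentIntegral {g : Space3 → ℝ} (hg : Measurable g) :
    Measurable (fun q : Space3 × (Sphere2 × ℝ) => segmentIntegral g q.1 q.2) := by
  have hS : MeasurableSet {z : (Space3 × (Sphere2 × ℝ)) × ℝ | z.2 ∈ Ioc 0 z.1.2.2} :=
    (measurableSet_lt measurable_const measurable_snd).inter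
      (measurableSet_le measurable_snd (by fun_prop))
  have hm : StronglyMeasurable ({z : (Space3 × (Sphere2 × ℝ)) × ℝ | z.2 ∈ Ioc 0 z.1.2.2}.indicator
      fun z => g (z.1.1 - z.2 • (z.1.2.1 : Space3))) :=
    ((Measurable.indicator (by fun_prop) hS)).stronglyMeasurable
  convert (hm.integral_prod_right' (ν := volume)).measurable using 2 with q
  rw [segmentIntegral, ← integral_indicator measurableSet_Ioc]
  rfl

theorem abs_segmentIntegral_le {g : Space3 → ℝ} {M : ℝ} (hg : ∀ y, |g y| ≤ M) {R : ℝ}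
    (x : Space3) {p : Sphere2 × ℝ} (hp : p.2 ∈ Ioc 0 R) : |segmentIntegral g x p| ≤ M * R := by
  have hM : 0 ≤ M := (abs_nonneg _).trans (hg 0)
  have h := norm_setIntegral_le_of_norm_le_const (μ := volume) (s := Ioc 0 p.2)
    (f := fun t => g (x - t • (p.1 : Space3))) (C := M) (by simp) (fun t _ => hg _)
  rw [Real.volume_real_Ioc_of_le hp.1.le, sub_zero] at h
  exact h.trans (mul_le_mul_of_nonneg_left hp.2 hM)

theorem integrableOn_segment {g : Space3 → ℝ} (hm : Measurable g) {M : ℝ} (hg : ∀ y, |g y| ≤ M)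
    (x : Space3) (n : Sphere2) (R : ℝ) : IntegrableOn (fun t => g (x - t • (n : Space3))) (Ioc 0 R) :=
  Integrable.of_bound (by
    have : Measurable fun t : ℝ => g (x - t • (n : Space3)) := by fun_prop
    exact this.aestronglyMeasurable) M (Eventually.of_forall fun t => hg _)

theorem segmentIntegral_sub {g₁ g₂ : Space3 → ℝ} (hm₁ : Measurable g₁) (hm₂ : Measurable g₂)
    {M : ℝ} (hg₁ : ∀ y, |g₁ y| ≤ M) (hg₂ : ∀ y, |g₂ y| ≤ M) (x : Space3) (p : Sphere2 × ℝ) :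
    segmentIntegral (fun y => g₁ y - g₂ y) x p =
      segmentIntegral g₁ x p - segmentIntegral g₂ x p :=
  integral_sub (integrableOn_segment hm₁ hg₁ x _ _) (integrableOn_segment hm₂ hg₂ x _ _)

/-- The squared segment integral as a double integral over pairs of points of the segment. -/
theorem integral_segmentIntegral_sq {g : Space3 → ℝ} (hm : Measurable g) {M : ℝ}
    (hg : ∀ y, |g y| ≤ M) (R : ℝ) (x : Space3) :
    ∫ p, segmentIntegral g x p ^ 2 ∂rayMeasure R =
      ∫ θ in {θ : (Sphere2 × ℝ) × (ℝ × ℝ) | θ.2.1 ≤ θ.1.2 ∧ θ.2.2 ≤ θ.1.2},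
        g (x - θ.2.1 • (θ.1.1 : Space3)) * g (x - θ.2.2 • (θ.1.1 : Space3))
        ∂((rayMeasure R).prod ((volume.restrict (Ioc 0 R)).prod (volume.restrict (Ioc 0 R)))) := by
  have hS : MeasurableSet {θ : (Sphere2 × ℝ) × (ℝ × ℝ) | θ.2.1 ≤ θ.1.2 ∧ θ.2.2 ≤ θ.1.2} := by
    have h1 : MeasurableSet {θ : (Sphere2 × ℝ) × (ℝ × ℝ) | θ.2.1 ≤ θ.1.2} :=
      measurableSet_le (by fun_prop) (by fun_prop)
    have h2 : MeasurableSet {θ : (Sphere2 × ℝ) × (ℝ × ℝ) | θ.2.2 ≤ θ.1.2} :=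
      measurableSet_le (by fun_prop) (by fun_prop)
    exact h1.inter h2
  rw [← integral_indicator hS, integral_prod]
  · refine integral_congr_ae ?_
    filter_upwards [ae_rayMeasure_mem R] with p hp
    rw [sq, segmentIntegral_eq hp, ← integral_prod_mul]
    refine integral_congr_ae (Eventually.of_forall fun q => ?_)
    by_cases h1 : q.1 ≤ p.2 <;> by_cases h2 : q.2 ≤ p.2 <;> simp [indicator, h1, h2]
  · refine Integrable.of_bound (Measurable.aestronglyMeasurable ?_) (M * M)
      (Eventually.of_forall fun θ => ?_)
    · exact Measurable.indicator (by fun_prop) hS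
    · refine (norm_indicator_le_norm_self _ _).trans ?_
      rw [norm_mul]
      exact mul_le_mul (hg _) (hg _) (norm_nonneg _) ((abs_nonneg _).trans (hg 0))

theorem integrable_integral_segmentIntegral_sq {g : Space3 → ℝ} (hm : Measurable g) {M : ℝ}
    (hg : ∀ y, |g y| ≤ M) (hi : Integrable g) (R : ℝ) :
    Integrable fun x => ∫ p, segmentIntegral g x p ^ 2 ∂rayMeasure R := by
  simp_rw [integral_segmentIntegral_sq hm hg R]
  exact (integrable_prod_mul_shift _
    (a := fun θ : (Sphere2 × ℝ) × (ℝ × ℝ) => θ.2.1 • (θ.1.1 : Space3))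
    (c := fun θ => θ.2.2 • (θ.1.1 : Space3)) (by fun_prop) (by fun_prop) hm hg hi).integral_prod_left

/-- Segment integrals turn weak convergence into strong convergence. -/
theorem WeaklyNull.tendsto_integral_segmentIntegral_sq {ι : Type*} {l : Filter ι}
    [l.IsCountablyGenerated] {h : ι → Space3 → ℝ} (hw : WeaklyNull l h)
    (hm : ∀ i, Measurable (h i)) {M : ℝ}
    (hM : ∀ i y, |h i y| ≤ M) {b : Space3 → ℝ} (hb : Integrable b) (hhb : ∀ i y, |h i y| ≤ b y)
    (R : ℝ) :
    Tendsto (fun i => ∫ x, ∫ p, segmentIntegral (h i) x p ^ 2 ∂rayMeasure R) l (𝓝 0) := by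
  simp_rw [fun i x => integral_segmentIntegral_sq (hm i) (hM i) R x]
  refine hw.tendsto_integral_mul_shift hm hM hb hhb _
    (a := fun θ : (Sphere2 × ℝ) × (ℝ × ℝ) => θ.2.1 • (θ.1.1 : Space3))
    (c := fun θ => θ.2.2 • (θ.1.1 : Space3)) (by fun_prop) (by fun_prop) fun x => ?_
  -- The difference of the shifts is a multiple of `n` by the signed length `t' - t`, whose law is
  -- absolutely continuous; this is where radii of both signs are needed.
  have h1 : Measure.QuasiMeasurePreserving (Prod.map (Prod.fst : Sphere2 × ℝ → Sphere2)
      (fun q : ℝ × ℝ => q.2 - q.1))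
      ((rayMeasure R).prod ((volume.restrict (Ioc 0 R)).prod (volume.restrict (Ioc 0 R))))
      (surfaceMeasure.prod volume) := by
    refine QuasiMeasurePreserving.prodMap Measure.quasiMeasurePreserving_fst ?_
    refine Measure.QuasiMeasurePreserving.mono_left (μa := (volume : Measure ℝ).prod volume) ?_
      (Measure.restrict_le_self.absolutelyContinuous.prod
        Measure.restrict_le_self.absolutelyContinuous)
    exact (quasiMeasurePreserving_sub_of_right_invariant (volume : Measure ℝ) volume).comp
      Measure.measurePreserving_swap.quasiMeasurePreserving
  have h2 := ((quasiMeasurePreserving_sub_smul x).comp h1).mono_left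
    (Measure.restrict_le_self (s := {θ : (Sphere2 × ℝ) × (ℝ × ℝ) |
      θ.2.1 ≤ θ.1.2 ∧ θ.2.2 ≤ θ.1.2})).absolutelyContinuous
  convert h2 using 2 with θ
  simp only [Function.comp_apply, Prod.map_fst, Prod.map_snd, sub_smul]
  abel

/-! ### Two elementary inequalities -/

theorem abs_exp_neg_sub_exp_neg_le {a b C : ℝ} (ha : |a| ≤ C) (hb : |b| ≤ C) :
    |Real.exp (-a) - Real.exp (-b)| ≤ Real.exp C * |a - b| := by
  wlog hab : a ≤ b generalizing a b
  · rw [abs_sub_comm, abs_sub_comm a b]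
    exact this hb ha (le_of_not_ge hab)
  have h1 : Real.exp (-b) ≤ Real.exp (-a) := Real.exp_le_exp.2 (by linarith)
  rw [abs_of_nonneg (sub_nonneg.2 h1), abs_sub_comm, abs_of_nonneg (sub_nonneg.2 hab)]
  have h2 : Real.exp (-b) = Real.exp (-a) * Real.exp (-(b - a)) := by
    rw [← Real.exp_add]; ring_nf
  have h3 := Real.add_one_le_exp (-(b - a))
  have h4 : Real.exp (-a) ≤ Real.exp C := Real.exp_le_exp.2 (by linarith [neg_le_abs a])
  calc Real.exp (-a) - Real.exp (-b) = Real.exp (-a) * (1 - Real.exp (-(b - a))) := by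
        rw [h2]; ring
    _ ≤ Real.exp (-a) * (b - a) :=
        mul_le_mul_of_nonneg_left (by linarith) (Real.exp_pos _).le
    _ ≤ Real.exp C * (b - a) := mul_le_mul_of_nonneg_right h4 (sub_nonneg.2 hab)

/-- Cauchy–Schwarz against the constant `1`, obtained by integrating `(F - I / V) ^ 2 ≥ 0`, where `I
/ V` is the mean of `F`. -/
theorem sq_integral_le_measureReal_mul {α : Type*} [MeasurableSpace α] (μ : Measure α)
    [IsFiniteMeasure μ] {F : α → ℝ} (hF : Integrable F μ) (hF2 : Integrable (fun a => F a ^ 2) μ) :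
    (∫ a, F a ∂μ) ^ 2 ≤ μ.real univ * ∫ a, F a ^ 2 ∂μ := by
  rcases eq_or_ne (μ.real univ) 0 with hV | hV
  · have : μ = 0 := by
      rw [measureReal_eq_zero_iff] at hV
      exact Measure.measure_univ_eq_zero.1 hV
    simp [this]
  have hV' : 0 < μ.real univ := lt_of_le_of_ne measureReal_nonneg hV.symm
  set V := μ.real univ with hVdef
  set I := ∫ a, F a ∂μ with hI
  have h : ∫ a, 2 * (I / V) * F a ∂μ ≤ ∫ a, (F a ^ 2 + (I / V) ^ 2) ∂μ :=
    integral_mono (hF.const_mul _) (hF2.add (integrable_const _)) fun a => by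
      simp only
      nlinarith [sq_nonneg (F a - I / V)]
  rw [integral_const_mul, integral_add hF2 (integrable_const _), integral_const, ← hI,
    smul_eq_mul, ← hVdef] at h
  have e1 : 2 * (I / V) * I = 2 * (I ^ 2 / V) := by ring
  have e2 : V * (I / V) ^ 2 = I ^ 2 / V := by field_simp
  rw [e1, e2] at h
  have h2 : I ^ 2 / V ≤ ∫ a, F a ^ 2 ∂μ := by linarith
  rwa [div_le_iff₀' hV'] at h2

/-! ### Ray integrals against a fixed weight -/

/-- A property that holds for almost every `y` in each direction `n` holds along almost every ray
through almost every point. -/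
theorem ae_ae_rayMeasure {P : Space3 → Sphere2 → Prop}
    (hP : MeasurableSet {q : Space3 × Sphere2 | P q.1 q.2})
    (h : ∀ n, ∀ᵐ y : Space3, P y n) (R : ℝ) :
    ∀ᵐ x : Space3, ∀ᵐ p ∂rayMeasure R, P (x - p.2 • (p.1 : Space3)) p.1 := by
  have hm : Measurable fun z : Space3 × (Sphere2 × ℝ) =>
      (z.1 - z.2.2 • (z.2.1 : Space3), z.2.1) := by fun_prop
  -- After exchanging quantifiers by Fubini, `p` is fixed and `x` is merely translated, which
  -- preserves null sets.
  refine (Measure.ae_ae_comm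
    (p := fun x (p : Sphere2 × ℝ) => P (x - p.2 • (p.1 : Space3)) p.1) (hm hP)).2
    (Eventually.of_forall fun p => ?_)
  exact (measurePreserving_sub_right volume (p.2 • (p.1 : Space3))).quasiMeasurePreserving.ae (h p.1)

/-- The weighted ray measure, pushed forward to space by polar coordinates around `x`, is finite and
absolutely continuous, hence an admissible test measure. -/
theorem WeaklyNull.tendsto_integral_ray_mul {ι : Type*} {l : Filter ι} {h : ι → Space3 → ℝ}
    (hw : WeaklyNull l h) (hm : ∀ i, Measurable (h i)) (R : ℝ) (x : Space3)
    {w : Sphere2 × ℝ → ℝ} (hwm : Measurable w) (hw0 : ∀ p, 0 ≤ w p)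
    (hwi : Integrable w (rayMeasure R)) :
    Tendsto (fun i => ∫ p, h i (x - p.2 • (p.1 : Space3)) * w p ∂rayMeasure R) l (𝓝 0) := by
  set ρ := (rayMeasure R).withDensity fun p => ENNReal.ofReal (w p) with hρ
  have hfin : IsFiniteMeasure ρ := isFiniteMeasure_withDensity_ofReal hwi.2
  have hq := (quasiMeasurePreserving_ray R x).mono_left
    (withDensity_absolutelyContinuous (rayMeasure R) fun p => ENNReal.ofReal (w p))
  refine (hw (ρ.map fun p => x - p.2 • (p.1 : Space3)) inferInstance
    hq.absolutelyContinuous).congr fun i => ?_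
  rw [integral_map hq.measurable.aemeasurable (hm i).aestronglyMeasurable, hρ,
    integral_withDensity_eq_integral_toReal_smul (by fun_prop)
      (Eventually.of_forall fun _ => ENNReal.ofReal_lt_top)]
  refine integral_congr_ae (Eventually.of_forall fun p => ?_)
  simp only [ENNReal.toReal_ofReal (hw0 p), smul_eq_mul, mul_comm]

/-- If each `H · · m` with `m` in the range of the simple function `s` is weakly null, then so are
the ray integrals with directional dependence discretized by `s`. -/
theorem tendsto_integral_ray_simpleFunc {ι : Type*} {l : Filter ι}
    {H : ι → Space3 → Sphere2 → ℝ} (hm : ∀ i n, Measurable fun y => H i y n) {M : ℝ}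
    (hM : ∀ i y n, |H i y n| ≤ M) (s : SimpleFunc Sphere2 Sphere2)
    (hw : ∀ n, WeaklyNull l fun i y => H i y (s n)) (R : ℝ) (x : Space3)
    {w : Sphere2 × ℝ → ℝ} (hwm : Measurable w) (hw0 : ∀ p, 0 ≤ w p)
    (hwi : Integrable w (rayMeasure R)) :
    Tendsto (fun i => ∫ p, H i (x - p.2 • (p.1 : Space3)) (s p.1) * w p ∂rayMeasure R) l (𝓝 0) := by
  have hS : ∀ m, MeasurableSet {p : Sphere2 × ℝ | s p.1 = m} := fun m =>
    measurable_fst (s.measurableSet_fiber m)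
  have hwi' : ∀ m, Integrable ({p : Sphere2 × ℝ | s p.1 = m}.indicator w) (rayMeasure R) := fun m =>
    hwi.indicator (hS m)
  -- On each fibre of `s` the direction argument of `H` is constant, so the fibre's indicator can be
  -- absorbed into the weight.
  have hsum : Tendsto (fun i => ∑ m ∈ s.range, ∫ p, H i (x - p.2 • (p.1 : Space3)) m *
      {p : Sphere2 × ℝ | s p.1 = m}.indicator w p ∂rayMeasure R) l (𝓝 (∑ m ∈ s.range, 0)) := by
    refine tendsto_finsetSum _ fun m hms => ?_
    obtain ⟨n, rfl⟩ := SimpleFunc.mem_range.1 hms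
    exact (hw n).tendsto_integral_ray_mul (fun i => hm i _) R x (hwm.indicator (hS _))
      (fun p => indicator_nonneg (fun p _ => hw0 p) p) (hwi' _)
  rw [Finset.sum_const_zero] at hsum
  refine hsum.congr fun i => ?_
  rw [← integral_finsetSum]
  · refine integral_congr_ae (Eventually.of_forall fun p => ?_)
    simp only
    rw [Finset.sum_eq_single_of_mem (s p.1) (s.mem_range_self p.1)]
    · simp [indicator]
    · intro m _ hne
      simp [indicator, hne.symm]
  · intro m _
    refine (hwi' m).bdd_mul (c := M) ?_ (Eventually.of_forall fun p => hM _ _ _)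
    have := (hm i m).comp (quasiMeasurePreserving_ray R x).measurable
    exact this.aestronglyMeasurable

/-- Discretizing the direction costs at most `K * ∫ ω k`, uniformly in `i`. Hence `k` can be fixed
before passing to the limit along `l`. -/
theorem tendsto_integral_ray_of_approx {ι : Type*} {l : Filter ι}
    {H : ι → Space3 → Sphere2 → ℝ} (hm : ∀ i, Measurable fun q : Space3 × Sphere2 => H i q.1 q.2)
    {M : ℝ} (hM : ∀ i y n, |H i y n| ≤ M) {s : ℕ → SimpleFunc Sphere2 Sphere2}
    (hw : ∀ k n, WeaklyNull l fun i y => H i y (s k n)) {R : ℝ} {x : Space3}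
    {ω : ℕ → Sphere2 × ℝ → ℝ} (hωi : ∀ k, Integrable (ω k) (rayMeasure R))
    (hω : Tendsto (fun k => ∫ p, ω k p ∂rayMeasure R) atTop (𝓝 0))
    (hHω : ∀ i k, ∀ᵐ p ∂rayMeasure R, |H i (x - p.2 • (p.1 : Space3)) p.1 -
      H i (x - p.2 • (p.1 : Space3)) (s k p.1)| ≤ ω k p)
    {w : Sphere2 × ℝ → ℝ} (hwm : Measurable w) (hw0 : ∀ p, 0 ≤ w p) {K : ℝ}
    (hwK : ∀ᵐ p ∂rayMeasure R, w p ≤ K) :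
    Tendsto (fun i => ∫ p, H i (x - p.2 • (p.1 : Space3)) p.1 * w p ∂rayMeasure R) l (𝓝 0) := by
  have hwi : Integrable w (rayMeasure R) := Integrable.of_bound hwm.aestronglyMeasurable K <| by
    filter_upwards [hwK] with p hp
    rwa [Real.norm_eq_abs, abs_of_nonneg (hw0 p)]
  have hint : ∀ i (s : Sphere2 → Sphere2), Measurable s →
      Integrable (fun p => H i (x - p.2 • (p.1 : Space3)) (s p.1) * w p) (rayMeasure R) := by
    intro i s hs
    refine hwi.bdd_mul (c := M) ?_ (Eventually.of_forall fun p => hM _ _ _)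
    have : Measurable fun p : Sphere2 × ℝ => (x - p.2 • (p.1 : Space3), s p.1) := by fun_prop
    exact ((hm i).comp this).aestronglyMeasurable
  rw [Metric.tendsto_nhds]
  intro ε hε
  have hω' : Tendsto (fun k => K * ∫ p, ω k p ∂rayMeasure R) atTop (𝓝 0) := by
    simpa using hω.const_mul K
  obtain ⟨k, hk⟩ := ((tendsto_order.1 hω').2 (ε / 2) (by positivity)).exists
  have h1 := tendsto_integral_ray_simpleFunc (H := H)
    (fun i n => (hm i).comp measurable_prodMk_right) hM
    (s k) (hw k) R x hwm hw0 hwi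
  filter_upwards [Metric.tendsto_nhds.1 h1 (ε / 2) (by positivity)] with i hi
  rw [Real.dist_eq, sub_zero] at hi ⊢
  have h2 : |∫ p, (H i (x - p.2 • (p.1 : Space3)) p.1 * w p -
      H i (x - p.2 • (p.1 : Space3)) (s k p.1) * w p) ∂rayMeasure R| ≤
      K * ∫ p, ω k p ∂rayMeasure R := by
    rw [← integral_const_mul, ← Real.norm_eq_abs]
    refine norm_integral_le_of_norm_le ((hωi k).const_mul K) ?_
    filter_upwards [hHω i k, hwK] with p h3 h4
    rw [← sub_mul, norm_mul, Real.norm_eq_abs, Real.norm_eq_abs, abs_of_nonneg (hw0 p), mul_comm]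
    exact mul_le_mul h4 h3 (abs_nonneg _) ((hw0 p).trans h4)
  rw [integral_sub (hint i (fun n => n) measurable_id) (hint i _ (s k).measurable)] at h2
  rw [abs_lt] at hi ⊢
  have h4 := abs_lt.1 (h2.trans_lt hk)
  constructor <;> linarith [h4.1, h4.2]

/-! ### Ray averages and their mean-square Cauchy property -/

/-- The attenuated integral of `f` over rays of length `R` ending at `x`, as a single integral. -/
noncomputable def rayAverage (R : ℝ) (f : Space3 → Sphere2 → ℝ) (g : Space3 → ℝ) (x : Space3) : ℝ :=
  ∫ p, f (x - p.2 • (p.1 : Space3)) p.1 * Real.exp (-segmentIntegral g x p) ∂rayMeasure R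

theorem measurable_rayIntegrand {f : Space3 → Sphere2 → ℝ}
    (hf : Measurable fun q : Space3 × Sphere2 => f q.1 q.2) {g : Space3 → ℝ} (hg : Measurable g) :
    Measurable fun q : Space3 × (Sphere2 × ℝ) =>
      f (q.1 - q.2.2 • (q.2.1 : Space3)) q.2.1 * Real.exp (-segmentIntegral g q.1 q.2) := by
  have h1 : Measurable fun q : Space3 × (Sphere2 × ℝ) =>
      (q.1 - q.2.2 • (q.2.1 : Space3), q.2.1) := by fun_prop
  exact (hf.comp h1).mul (Real.measurable_exp.comp (measurable_segmentIntegral hg).neg)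

theorem measurable_rayAverage (R : ℝ) {f : Space3 → Sphere2 → ℝ}
    (hf : Measurable fun q : Space3 × Sphere2 => f q.1 q.2) {g : Space3 → ℝ} (hg : Measurable g) :
    Measurable (rayAverage R f g) :=
  ((measurable_rayIntegrand hf hg).stronglyMeasurable.integral_prod_right'
    (ν := rayMeasure R)).measurable

theorem ae_exp_neg_segmentIntegral_le {g : Space3 → ℝ} {M : ℝ} (hM : ∀ y, |g y| ≤ M) (R : ℝ)
    (x : Space3) :
    ∀ᵐ p ∂rayMeasure R, Real.exp (-segmentIntegral g x p) ≤ Real.exp (M * R) := by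
  filter_upwards [ae_rayMeasure_mem R] with p hp
  exact Real.exp_le_exp.2 ((neg_le_abs _).trans (abs_segmentIntegral_le hM x hp))

theorem ae_abs_rayIntegrand_le {f : Space3 → Sphere2 → ℝ} {g : Space3 → ℝ} {M : ℝ}
    (hfM : ∀ y n, |f y n| ≤ M) (hgM : ∀ y, |g y| ≤ M) (R : ℝ) (x : Space3) :
    ∀ᵐ p ∂rayMeasure R, ‖f (x - p.2 • (p.1 : Space3)) p.1 * Real.exp (-segmentIntegral g x p)‖ ≤
      M * Real.exp (M * R) := by
  filter_upwards [ae_exp_neg_segmentIntegral_le hgM R x] with p hp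
  rw [norm_mul, Real.norm_eq_abs, Real.norm_eq_abs, Real.abs_exp]
  exact mul_le_mul (hfM _ _) hp (Real.exp_pos _).le ((abs_nonneg _).trans (hgM 0))

theorem integrable_rayIntegrand {f : Space3 → Sphere2 → ℝ} {g : Space3 → ℝ} {M : ℝ}
    (hf : Measurable fun q : Space3 × Sphere2 => f q.1 q.2) (hg : Measurable g)
    (hfM : ∀ y n, |f y n| ≤ M) (hgM : ∀ y, |g y| ≤ M) (R : ℝ) (x : Space3) :
    Integrable (fun p => f (x - p.2 • (p.1 : Space3)) p.1 * Real.exp (-segmentIntegral g x p))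
      (rayMeasure R) :=
  Integrable.of_bound
    ((measurable_rayIntegrand hf hg).comp (measurable_prodMk_left (x := x))).aestronglyMeasurable _
    (ae_abs_rayIntegrand_le hfM hgM R x)

theorem abs_rayAverage_le {f : Space3 → Sphere2 → ℝ} {g : Space3 → ℝ} {M : ℝ}
    (hfM : ∀ y n, |f y n| ≤ M) (hgM : ∀ y, |g y| ≤ M) (R : ℝ) (x : Space3) :
    ‖rayAverage R f g x‖ ≤ M * Real.exp (M * R) * (rayMeasure R).real univ :=
  norm_integral_le_of_norm_le_const (ae_abs_rayIntegrand_le hfM hgM R x)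

theorem integrable_segmentIntegral_sq {g : Space3 → ℝ} (hg : Measurable g) {M : ℝ}
    (hgM : ∀ y, |g y| ≤ M) (R : ℝ) (x : Space3) :
    Integrable (fun p => segmentIntegral g x p ^ 2) (rayMeasure R) := by
  refine Integrable.of_bound (((measurable_segmentIntegral hg).comp
    (measurable_prodMk_left (x := x))).pow_const 2).aestronglyMeasurable ((M * R) ^ 2) ?_
  filter_upwards [ae_rayMeasure_mem R] with p hp
  rw [norm_pow, Real.norm_eq_abs]
  exact pow_le_pow_left₀ (abs_nonneg _) (abs_segmentIntegral_le hgM x hp) 2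

/-- Changing the attenuation coefficient changes the ray average continuously. -/
theorem sq_rayAverage_sub_le {f : Space3 → Sphere2 → ℝ} {g₁ g₂ : Space3 → ℝ} {M : ℝ}
    (hf : Measurable fun q : Space3 × Sphere2 => f q.1 q.2) (hg₁ : Measurable g₁)
    (hg₂ : Measurable g₂) (hfM : ∀ y n, |f y n| ≤ M) (hgM₁ : ∀ y, |g₁ y| ≤ M)
    (hgM₂ : ∀ y, |g₂ y| ≤ M) (R : ℝ) (x : Space3) :
    (rayAverage R f g₁ x - rayAverage R f g₂ x) ^ 2 ≤ (rayMeasure R).real univ *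
      ((M * Real.exp (M * R)) ^ 2 *
        ∫ p, segmentIntegral (fun y => g₁ y - g₂ y) x p ^ 2 ∂rayMeasure R) := by
  have i1 := integrable_rayIntegrand hf hg₁ hfM hgM₁ R x
  have i2 := integrable_rayIntegrand hf hg₂ hfM hgM₂ R x
  have hgM : ∀ y, |g₁ y - g₂ y| ≤ M + M := fun y =>
    (abs_sub _ _).trans (add_le_add (hgM₁ y) (hgM₂ y))
  have i3 := integrable_segmentIntegral_sq (hg₁.sub hg₂) hgM R x
  have hle : ∀ᵐ p ∂rayMeasure R,
      (f (x - p.2 • (p.1 : Space3)) p.1 * Real.exp (-segmentIntegral g₁ x p) -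
        f (x - p.2 • (p.1 : Space3)) p.1 * Real.exp (-segmentIntegral g₂ x p)) ^ 2 ≤
      (M * Real.exp (M * R)) ^ 2 * segmentIntegral (fun y => g₁ y - g₂ y) x p ^ 2 := by
    filter_upwards [ae_rayMeasure_mem R] with p hp
    rw [segmentIntegral_sub hg₁ hg₂ hgM₁ hgM₂, ← mul_sub, ← mul_pow, ← sq_abs (_ * (_ - _)),
      ← sq_abs (_ * _ * (_ - _)), abs_mul, abs_mul]
    have h0 : (0 : ℝ) ≤ M := (abs_nonneg _).trans (hgM₁ 0)
    rw [abs_of_nonneg (by positivity : 0 ≤ M * Real.exp (M * R)), mul_assoc]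
    gcongr
    · exact hfM _ _
    · exact abs_exp_neg_sub_exp_neg_le (abs_segmentIntegral_le hgM₁ x hp)
        (abs_segmentIntegral_le hgM₂ x hp)
  have i4 := i3.const_mul ((M * Real.exp (M * R)) ^ 2)
  have hsq : Integrable (fun p =>
      (f (x - p.2 • (p.1 : Space3)) p.1 * Real.exp (-segmentIntegral g₁ x p) -
        f (x - p.2 • (p.1 : Space3)) p.1 * Real.exp (-segmentIntegral g₂ x p)) ^ 2)
      (rayMeasure R) := by
    refine i4.mono' ((i1.sub i2).aestronglyMeasurable.pow 2) ?_
    filter_upwards [hle] with p hp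
    rwa [Real.norm_eq_abs, abs_of_nonneg (sq_nonneg _)]
  rw [rayAverage, rayAverage, ← integral_sub i1 i2, ← integral_const_mul]
  refine (sq_integral_le_measureReal_mul _ (i1.sub i2) hsq).trans ?_
  exact mul_le_mul_of_nonneg_left (integral_mono_ae hsq i4 hle) measureReal_nonneg

/-- Weakly Cauchy coefficients give ray averages that are Cauchy in mean square. -/
theorem eventually_integral_sq_rayAverage_sub_lt {f : ℕ → Space3 → Sphere2 → ℝ}
    {g : ℕ → Space3 → ℝ} (hf : ∀ j, Measurable fun q : Space3 × Sphere2 => f j q.1 q.2)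
    (hg : ∀ j, Measurable (g j)) {M : ℝ} (hfM : ∀ j y n, |f j y n| ≤ M)
    (hgM : ∀ j y, |g j y| ≤ M) {b : Space3 → ℝ} (hb : Integrable b) (hgb : ∀ j y, |g j y| ≤ b y)
    {s : ℕ → SimpleFunc Sphere2 Sphere2}
    (hfw : ∀ k n, WeaklyNull atTop fun (q : ℕ × ℕ) y => f q.1 y (s k n) - f q.2 y (s k n))
    (hgw : WeaklyNull atTop fun (q : ℕ × ℕ) y => g q.1 y - g q.2 y)
    (R : ℝ) {ω : ℕ → Sphere2 × ℝ → ℝ} (hωi : ∀ k, Integrable (ω k) (rayMeasure R))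
    (hω : Tendsto (fun k => ∫ p, ω k p ∂rayMeasure R) atTop (𝓝 0))
    {μ : Measure Space3} [IsFiniteMeasure μ] (hμ : μ ≤ volume)
    (hfω : ∀ᵐ x ∂μ, ∀ i k, ∀ᵐ p ∂rayMeasure R, |f i (x - p.2 • (p.1 : Space3)) p.1 -
      f i (x - p.2 • (p.1 : Space3)) (s k p.1)| ≤ ω k p) {ε : ℝ} (hε : 0 < ε) :
    ∀ᶠ q : ℕ × ℕ in atTop,
      ∫ x, (rayAverage R (f q.1) (g q.1) x - rayAverage R (f q.2) (g q.2) x) ^ 2 ∂μ < ε := by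
  set V := (rayMeasure R).real univ with hV
  set K := Real.exp (M * R) with hK
  set C := V * (M * K) ^ 2 with hC
  have hC0 : 0 ≤ C := mul_nonneg measureReal_nonneg (sq_nonneg _)
  set D : ℕ × ℕ → Space3 → ℝ := fun q x =>
    ∫ p, segmentIntegral (fun y => g q.1 y - g q.2 y) x p ^ 2 ∂rayMeasure R with hD
  have hgM2 : ∀ (q : ℕ × ℕ) y, |g q.1 y - g q.2 y| ≤ M + M := fun q y =>
    (abs_sub _ _).trans (add_le_add (hgM _ y) (hgM _ y))
  have hgb2 : ∀ (q : ℕ × ℕ) y, |g q.1 y - g q.2 y| ≤ b y + b y := fun q y =>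
    (abs_sub _ _).trans (add_le_add (hgb _ y) (hgb _ y))
  have hDt : Tendsto (fun q => 3 * C * ∫ x, D q x) atTop (𝓝 0) := by
    simpa using (hgw.tendsto_integral_segmentIntegral_sq (fun q => (hg _).sub (hg _)) hgM2
      (hb.add hb) hgb2 R).const_mul (3 * C)
  have hDi : ∀ q, Integrable (D q) := fun q =>
    integrable_integral_segmentIntegral_sq ((hg _).sub (hg _)) (hgM2 q)
      ((hb.add hb).mono' ((hg _).sub (hg _)).aestronglyMeasurable (Eventually.of_forall (hgb2 q))) R
  have hD0 : ∀ q x, 0 ≤ D q x := fun q x => integral_nonneg fun p => sq_nonneg _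
  have hDμ : ∀ q, ∫ x, D q x ∂μ ≤ ∫ x, D q x := fun q =>
    integral_mono_measure hμ (Eventually.of_forall (hD0 q)) (hDi q)
  -- From the index `N` on, replacing the attenuation `g i` by `g N` costs less than `ε / 3` in mean
  -- square, with the factor 3 of the later splitting included.
  obtain ⟨⟨N₁, N₂⟩, hN⟩ := eventually_atTop.1 ((tendsto_order.1 hDt).2 (ε / 3) (by positivity))
  set N := max N₁ N₂ with hNdef
  have hN' : ∀ i, N ≤ i → 3 * C * ∫ x, D (i, N) x < ε / 3 := fun i hi =>
    hN (i, N) ⟨(le_max_left _ _).trans hi, le_max_right _ _⟩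
  -- Both averages use the same attenuation `g N`, so the exponential is a fixed weight and only the
  -- source varies weakly.
  set A : ℕ × ℕ → Space3 → ℝ := fun q x =>
    rayAverage R (f q.1) (g N) x - rayAverage R (f q.2) (g N) x with hA
  have hAm : ∀ q, Measurable (A q) := fun q =>
    (measurable_rayAverage R (hf _) (hg _)).sub (measurable_rayAverage R (hf _) (hg _))
  have hAb : ∀ q x, ‖A q x‖ ≤ M * K * V + M * K * V := fun q x =>
    (norm_sub_le _ _).trans (add_le_add (abs_rayAverage_le (hfM _) (hgM _) R x)
      (abs_rayAverage_le (hfM _) (hgM _) R x))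
  have hA2b : ∀ q x, ‖A q x ^ 2‖ ≤ (M * K * V + M * K * V) ^ 2 := fun q x => by
    rw [norm_pow]; exact pow_le_pow_left₀ (norm_nonneg _) (hAb q x) 2
  have hAx : ∀ᵐ x ∂μ, Tendsto (fun q => A q x) atTop (𝓝 0) := by
    filter_upwards [hfω] with x hx
    have h1 := tendsto_integral_ray_of_approx (l := atTop) (R := R) (x := x)
      (H := fun (q : ℕ × ℕ) y n => f q.1 y n - f q.2 y n) (fun q => (hf _).sub (hf _))
      (M := M + M) (fun q y n => (abs_sub _ _).trans (add_le_add (hfM _ y n) (hfM _ y n))) hfw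
      (ω := fun k p => ω k p + ω k p) (fun k => (hωi k).add (hωi k))
      (by simpa [integral_add (hωi _) (hωi _)] using hω.add hω)
      (fun q k => by
        filter_upwards [hx q.1 k, hx q.2 k] with p h1 h2
        rw [sub_sub_sub_comm]
        exact (abs_sub _ _).trans (add_le_add h1 h2))
      (w := fun p => Real.exp (-segmentIntegral (g N) x p))
      (Real.measurable_exp.comp ((measurable_segmentIntegral (hg N)).comp
        (measurable_prodMk_left (x := x))).neg)
      (fun p => (Real.exp_pos _).le) (ae_exp_neg_segmentIntegral_le (hgM N) R x)
    refine h1.congr fun q => ?_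
    simp only [hA, rayAverage, sub_mul]
    exact integral_sub (integrable_rayIntegrand (hf _) (hg _) (hfM _) (hgM _) R x)
      (integrable_rayIntegrand (hf _) (hg _) (hfM _) (hgM _) R x)
  have hAt : Tendsto (fun q => 3 * ∫ x, A q x ^ 2 ∂μ) atTop (𝓝 0) := by
    have := tendsto_integral_filter_of_dominated_convergence (μ := μ) (l := atTop)
      (F := fun q x => A q x ^ 2) (f := fun _ => (0 : ℝ))
      (fun _ => (M * K * V + M * K * V) ^ 2)
      (Eventually.of_forall fun q => ((hAm q).pow_const 2).aestronglyMeasurable)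
      (Eventually.of_forall fun q => Eventually.of_forall (hA2b q))
      (integrable_const _) (by filter_upwards [hAx] with x hx; simpa using hx.pow 2)
    simpa using this.const_mul 3
  filter_upwards [(tendsto_order.1 hAt).2 (ε / 3) (by positivity),
    eventually_ge_atTop (N, N)] with q hq hqN
  have hA2i : Integrable (fun x => A q x ^ 2) μ :=
    Integrable.of_bound ((hAm q).pow_const 2).aestronglyMeasurable _
      (Eventually.of_forall (hA2b q))
  have hDiμ : ∀ q, Integrable (D q) μ := fun q => (hDi q).mono_measure hμ
  -- The difference splits into the frozen term `A` and two changes of attenuation; the factor 3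
  -- comes from squaring a sum of three terms.
  have hle : ∀ x, (rayAverage R (f q.1) (g q.1) x - rayAverage R (f q.2) (g q.2) x) ^ 2 ≤
      3 * A q x ^ 2 + (3 * C * D (q.1, N) x + 3 * C * D (q.2, N) x) := by
    intro x
    have h1 := sq_rayAverage_sub_le (hf q.1) (hg q.1) (hg N) (hfM _) (hgM _) (hgM _) R x
    have h2 := sq_rayAverage_sub_le (hf q.2) (hg q.2) (hg N) (hfM _) (hgM _) (hgM _) R x
    rw [← mul_assoc] at h1 h2
    change _ ≤ C * D (q.1, N) x at h1
    change _ ≤ C * D (q.2, N) x at h2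
    have h3 : ∀ a b c : ℝ, (a + b - c) ^ 2 ≤ 3 * a ^ 2 + (3 * b ^ 2 + 3 * c ^ 2) := fun a b c => by
      nlinarith [sq_nonneg (a - b), sq_nonneg (a + c), sq_nonneg (b + c)]
    have h4 := h3 (A q x) (rayAverage R (f q.1) (g q.1) x - rayAverage R (f q.1) (g N) x)
      (rayAverage R (f q.2) (g q.2) x - rayAverage R (f q.2) (g N) x)
    have e : A q x + (rayAverage R (f q.1) (g q.1) x - rayAverage R (f q.1) (g N) x) -
      (rayAverage R (f q.2) (g q.2) x - rayAverage R (f q.2) (g N) x) =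
      rayAverage R (f q.1) (g q.1) x - rayAverage R (f q.2) (g q.2) x := by
      simp only [hA]; ring
    rw [e] at h4
    linarith
  have i1 : Integrable (fun x => 3 * C * D (q.1, N) x + 3 * C * D (q.2, N) x) μ :=
    ((hDiμ _).const_mul _).add ((hDiμ _).const_mul _)
  have hfin : ∫ x, (3 * A q x ^ 2 + (3 * C * D (q.1, N) x + 3 * C * D (q.2, N) x)) ∂μ < ε := by
    rw [integral_add (hA2i.const_mul 3) i1,
      integral_add ((hDiμ _).const_mul _) ((hDiμ _).const_mul _), integral_const_mul,
      integral_const_mul, integral_const_mul]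
    have h1 := mul_le_mul_of_nonneg_left (hDμ (q.1, N)) (by positivity : 0 ≤ 3 * C)
    have h2 := mul_le_mul_of_nonneg_left (hDμ (q.2, N)) (by positivity : 0 ≤ 3 * C)
    linarith [hN' q.1 hqN.1, hN' q.2 hqN.2]
  refine lt_of_le_of_lt ?_ hfin
  exact integral_mono_of_nonneg (Eventually.of_forall fun x => sq_nonneg _)
    ((hA2i.const_mul 3).add i1) (Eventually.of_forall hle)

/-! ### Discretized directions and measurable versions -/

theorem ae_abs_coeFn_le_norm {Ω : Set Space3} (g : LpOn ∞ Ω) :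
    ∀ᵐ y ∂volume.restrict Ω, |g y| ≤ ‖g‖ := by
  filter_upwards [ae_le_eLpNormEssSup (f := g) (μ := volume.restrict Ω)] with y hy
  rw [← eLpNorm_exponent_top] at hy
  have := ENNReal.toReal_mono (Lp.eLpNorm_ne_top g) hy
  rwa [toReal_enorm] at this

theorem ae_abs_sub_le_norm_sub {Ω : Set Space3} (g₁ g₂ : LpOn ∞ Ω) :
    ∀ᵐ y ∂volume.restrict Ω, |g₁ y - g₂ y| ≤ ‖g₁ - g₂‖ := by
  filter_upwards [ae_abs_coeFn_le_norm (g₁ - g₂), Lp.coeFn_sub g₁ g₂] with y h1 h2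
  rwa [h2] at h1

/-- The map sending a direction to the nearest among the first `k + 1` points of a dense sequence. -/
noncomputable def directionApprox (k : ℕ) : SimpleFunc Sphere2 Sphere2 :=
  haveI : Nonempty Sphere2 := (NormedSpace.sphere_nonempty.2 zero_le_one).to_subtype
  SimpleFunc.nearestPt (TopologicalSpace.denseSeq Sphere2) k

/-- All the approximations take values in one countable family independent of `k`, so a single
subsequence serves every `k`. The `ℕ`-valued index also makes joint measurability a matter of
countably many sections. -/
theorem exists_directionApprox_eq : ∃ (e : ℕ → Sphere2) (ind : ℕ → SimpleFunc Sphere2 ℕ),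
    ∀ k n, directionApprox k n = e (ind k n) := by
  have : Nonempty Sphere2 := (NormedSpace.sphere_nonempty.2 zero_le_one).to_subtype
  exact ⟨TopologicalSpace.denseSeq Sphere2,
    SimpleFunc.nearestPtInd (TopologicalSpace.denseSeq Sphere2), fun _ _ => rfl⟩

theorem tendsto_directionApprox (n : Sphere2) :
    Tendsto (fun k => directionApprox k n) atTop (𝓝 n) := by
  have : Nonempty Sphere2 := (NormedSpace.sphere_nonempty.2 zero_le_one).to_subtype
  exact SimpleFunc.tendsto_nearestPt (TopologicalSpace.denseRange_denseSeq Sphere2 n)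

/-- A continuous `L^∞`-valued map on the sphere has a jointly measurable version. -/
theorem exists_isMeasurableVersion (Ω : Set Space3) (Φ : C(Sphere2, LpOn ∞ Ω)) :
    ∃ f, IsMeasurableVersion Ω Φ f := by
  obtain ⟨e, ind, hind⟩ := exists_directionApprox_eq
  -- An upper limit is measurable whether or not the sequence converges. For each `n` it is a true
  -- limit at almost every `x`, as `Φ` is norm continuous; the exceptional set may depend on `n`.
  refine ⟨fun x n => limsup (fun k => Φ (directionApprox k n) x) atTop, ?_, fun n => ?_⟩
  · refine Measurable.limsup fun k => ?_
    simp only [hind]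
    have h1 : Measurable fun q : Space3 × ℕ => Φ (e q.2) q.1 :=
      measurable_from_prod_countable_left fun m => (Lp.stronglyMeasurable (Φ (e m))).measurable
    have h2 : Measurable fun q : Space3 × Sphere2 => (q.1, ind k q.2) :=
      measurable_fst.prodMk ((ind k).measurable.comp measurable_snd)
    exact h1.comp h2
  · have h : ∀ᵐ x ∂volume.restrict Ω, ∀ k,
        |Φ (directionApprox k n) x - Φ n x| ≤ ‖Φ (directionApprox k n) - Φ n‖ :=
      ae_all_iff.2 fun k => ae_abs_sub_le_norm_sub _ _
    filter_upwards [h] with x hx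
    refine Tendsto.limsup_eq ?_
    rw [tendsto_iff_norm_sub_tendsto_zero]
    have h1 := tendsto_iff_norm_sub_tendsto_zero.1
      ((Φ.continuous.tendsto n).comp (tendsto_directionApprox n))
    exact squeeze_zero (fun k => norm_nonneg _) hx h1

/-! ### Truncation and independence of representatives -/

/-- Truncation of a function to values in `[-M, M]`, extended by zero outside `Ω`. -/
noncomputable def truncate (Ω : Set Space3) (M : ℝ) (g : Space3 → ℝ) : Space3 → ℝ :=
  Ω.indicator fun y => max (-M) (min M (g y))

theorem measurable_truncate {Ω : Set Space3} (hΩ : MeasurableSet Ω) (M : ℝ) {g : Space3 → ℝ}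
    (hg : Measurable g) : Measurable (truncate Ω M g) :=
  Measurable.indicator (by fun_prop) hΩ

theorem measurable_truncate_uncurry {Ω : Set Space3} (hΩ : MeasurableSet Ω) (M : ℝ)
    {f : Space3 → Sphere2 → ℝ} (hf : Measurable fun q : Space3 × Sphere2 => f q.1 q.2) :
    Measurable fun q : Space3 × Sphere2 => truncate Ω M (fun y => f y q.2) q.1 := by
  have h : Measurable fun q : Space3 × Sphere2 => max (-M) (min M (f q.1 q.2)) := by fun_prop
  exact h.indicator (hΩ.preimage measurable_fst)

theorem abs_truncate_le_indicator (Ω : Set Space3) {M : ℝ} (hM : 0 ≤ M) (g : Space3 → ℝ)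
    (y : Space3) : |truncate Ω M g y| ≤ Ω.indicator (fun _ => M) y := by
  by_cases hy : y ∈ Ω
  · simp only [truncate, indicator_of_mem hy]
    exact abs_le.2 ⟨le_max_left _ _, max_le (by linarith) (min_le_left _ _)⟩
  · simp [truncate, hy]

theorem abs_truncate_le (Ω : Set Space3) {M : ℝ} (hM : 0 ≤ M) (g : Space3 → ℝ) (y : Space3) :
    |truncate Ω M g y| ≤ M :=
  (abs_truncate_le_indicator Ω hM g y).trans (indicator_le_self' (fun _ _ => hM) y)

theorem ae_truncate_eq {Ω : Set Space3} (hΩ : MeasurableSet Ω) {M : ℝ} {g : Space3 → ℝ}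
    (hg : ∀ᵐ y ∂volume.restrict Ω, |g y| ≤ M) : ∀ᵐ y, truncate Ω M g y = Ω.indicator g y := by
  filter_upwards [(ae_restrict_iff' hΩ).1 hg] with y hy
  by_cases h : y ∈ Ω
  · have := abs_le.1 (hy h)
    simp [truncate, h, min_eq_right this.2, this.1]
  · simp [truncate, h]

/-- Altering `g` on a null set is harmless at every `x`, by polar coordinates. Altering `f(·, n)` on
a null set depending on `n` is harmless only at almost every `x`, by Fubini and translation
invariance. -/
theorem ae_attenuatedLineIntegral_eq {Ω : Set Space3} (hΩ : MeasurableSet Ω)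
    {f F : Space3 → Sphere2 → ℝ} {g G : Space3 → ℝ}
    (hf : Measurable fun q : Space3 × Sphere2 => f q.1 q.2)
    (hF : Measurable fun q : Space3 × Sphere2 => F q.1 q.2) (hG : Measurable G)
    {M : ℝ} (hFM : ∀ y n, |F y n| ≤ M) (hGM : ∀ y, |G y| ≤ M)
    (hfF : ∀ n, ∀ᵐ y, F y n = Ω.indicator (fun y => f y n) y)
    (hgG : ∀ᵐ y, G y = Ω.indicator g y) :
    ∀ᵐ x, AttenuatedIntegrable Ω f g x ∧
      attenuatedLineIntegral Ω f g x = rayAverage (Metric.diam Ω) F G x := by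
  set R := Metric.diam Ω
  have hR : 0 ≤ R := Metric.diam_nonneg
  have hP : MeasurableSet {q : Space3 × Sphere2 | F q.1 q.2 = Ω.indicator (fun y => f y q.2) q.1} :=
    measurableSet_eq_fun hF (hf.indicator (hΩ.preimage measurable_fst))
  filter_upwards [ae_ae_rayMeasure hP hfF R] with x hx
  have hn : ∀ᵐ n : Sphere2 ∂surfaceMeasure,
      ∀ᵐ t : ℝ, G (x - t • (n : Space3)) = Ω.indicator g (x - t • (n : Space3)) :=
    Measure.ae_ae_of_ae_prod ((quasiMeasurePreserving_sub_smul x).ae hgG)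
  have hnp : ∀ᵐ p ∂rayMeasure R,
      ∀ᵐ t : ℝ, G (x - t • (p.1 : Space3)) = Ω.indicator g (x - t • (p.1 : Space3)) :=
    Measure.quasiMeasurePreserving_fst.ae hn
  have heq : (fun p : Sphere2 × ℝ => attenuatedIntegrand Ω f g x p.1 p.2) =ᵐ[rayMeasure R]
      fun p => F (x - p.2 • (p.1 : Space3)) p.1 * Real.exp (-segmentIntegral G x p) := by
    filter_upwards [hx, hnp, ae_rayMeasure_mem R] with p h1 h2 h3
    rw [attenuatedIntegrand, ← h1, segmentIntegral, intervalIntegral.integral_of_le h3.1.le]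
    congr 3
    exact integral_congr_ae (ae_restrict_of_ae (by filter_upwards [h2] with t ht using ht.symm))
  have hint : Integrable (fun p : Sphere2 × ℝ => attenuatedIntegrand Ω f g x p.1 p.2)
      (rayMeasure R) := (integrable_rayIntegrand hF hG hFM hGM R x).congr heq.symm
  refine ⟨⟨?_, hint⟩, ?_⟩
  · filter_upwards [hn] with n h
    rw [intervalIntegrable_iff_integrableOn_Ioc_of_le hR]
    exact (integrableOn_segment hG hGM x n R).congr (ae_restrict_of_ae h)
  · rw [rayAverage, ← integral_congr_ae heq, rayMeasure, integral_prod _ hint,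
      attenuatedLineIntegral]
    simp_rw [intervalIntegral.integral_of_le (Metric.diam_nonneg (s := Ω)), R]

/-! ### The common subsequence and the directional modulus -/

theorem exists_subseq_eventually_integral_sq_lt {f : ℕ → Space3 → Sphere2 → ℝ}
    {g : ℕ → Space3 → ℝ} (hf : ∀ j, Measurable fun q : Space3 × Sphere2 => f j q.1 q.2)
    (hg : ∀ j, Measurable (g j)) {M : ℝ} (hfM : ∀ j y n, |f j y n| ≤ M)
    (hgM : ∀ j y, |g j y| ≤ M) {b : Space3 → ℝ} (hb : Integrable b) (hgb : ∀ j y, |g j y| ≤ b y)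
    {σ : ℝ → ℝ} (hσc : ContinuousOn σ (Ici 0)) (hσ0 : σ 0 = 0)
    (hfσ : ∀ j n₁ n₂, ∀ᵐ y, |f j y n₁ - f j y n₂| ≤
      σ (InnerProductGeometry.angle (n₁ : Space3) (n₂ : Space3)))
    (R : ℝ) {μ : Measure Space3} [IsFiniteMeasure μ] (hμ : μ ≤ volume) :
    ∃ s : ℕ → ℕ, StrictMono s ∧ ∀ ε > 0, ∀ᶠ q : ℕ × ℕ in atTop,
      ∫ x, (rayAverage R (f (s q.1)) (g (s q.1)) x -
        rayAverage R (f (s q.2)) (g (s q.2)) x) ^ 2 ∂μ < ε := by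
  obtain ⟨e, ind, hind⟩ := exists_directionApprox_eq
  -- Index `0` encodes the attenuation and index `m + 1` the source in direction `e m`, so one
  -- extraction handles them all.
  obtain ⟨s, hs, hw⟩ := exists_subseq_weaklyNull_sub
    (h := fun k j => Nat.casesOn k (g j) fun m y => f j y (e m)) (M := M)
    (fun k j => by
      cases k with
      | zero => exact hg j
      | succ m => exact (hf j).comp measurable_prodMk_right)
    (fun k j y => by
      cases k with
      | zero => exact hgM j y
      | succ m => exact hfM j y _)
  refine ⟨s, hs, fun ε hε => ?_⟩
  -- A continuous extension of `σ` to the whole line, which gives measurability of `ω` and a bound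
  -- on `[0, π]`, the range of the angle.
  set τ : ℝ → ℝ := fun t => σ (max t 0) with hτ
  have hτc : Continuous τ := hσc.comp_continuous (by fun_prop) fun t => mem_Ici.2 (le_max_right _ _)
  have hτσ : ∀ u v : Space3, τ (InnerProductGeometry.angle u v) =
      σ (InnerProductGeometry.angle u v) := fun u v => by
    rw [hτ]; simp only [max_eq_left (InnerProductGeometry.angle_nonneg u v)]
  obtain ⟨C, hC⟩ := isCompact_Icc.exists_bound_of_continuousOn (s := Icc (0 : ℝ) Real.pi)
    hτc.continuousOn
  set ω : ℕ → Sphere2 → ℝ := fun k n =>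
    τ (InnerProductGeometry.angle (n : Space3) (directionApprox k n : Space3)) with hω
  have hωm : ∀ k, Measurable (ω k) := fun k => by
    refine hτc.measurable.comp ?_
    have h1 : Measurable fun n : Sphere2 => (directionApprox k n : Space3) :=
      measurable_subtype_coe.comp (directionApprox k).measurable
    unfold InnerProductGeometry.angle
    fun_prop
  have hωC : ∀ k n, ‖ω k n‖ ≤ C := fun k n =>
    hC _ ⟨InnerProductGeometry.angle_nonneg _ _, InnerProductGeometry.angle_le_pi _ _⟩
  have hω0 : ∀ n, Tendsto (fun k => ω k n) atTop (𝓝 0) := by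
    intro n
    have hn : (n : Space3) ≠ 0 := by
      intro h
      have := norm_eq_of_mem_sphere n
      simp [h] at this
    have h1 : Tendsto (fun k => ((n : Space3), (directionApprox k n : Space3))) atTop
        (𝓝 ((n : Space3), (n : Space3))) :=
      tendsto_const_nhds.prodMk_nhds
        ((continuous_subtype_val.tendsto n).comp (tendsto_directionApprox n))
    have h2 := (hτc.tendsto _).comp
      ((InnerProductGeometry.continuousAt_angle (x := ((n : Space3), (n : Space3))) hn hn).tendsto.comp
        h1)
    have e0 : τ (InnerProductGeometry.angle (n : Space3) (n : Space3)) = 0 := by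
      simp [hτ, InnerProductGeometry.angle_self hn, hσ0]
    rwa [e0] at h2
  have hfω : ∀ᵐ x ∂μ, ∀ i k, ∀ᵐ p ∂rayMeasure R, |f (s i) (x - p.2 • (p.1 : Space3)) p.1 -
      f (s i) (x - p.2 • (p.1 : Space3)) (directionApprox k p.1)| ≤ ω k p.1 := by
    refine Measure.absolutelyContinuous_of_le hμ |>.ae_le ?_
    refine ae_all_iff.2 fun i => ae_all_iff.2 fun k => ?_
    refine ae_ae_rayMeasure (P := fun y n => |f (s i) y n - f (s i) y (directionApprox k n)| ≤ ω k n)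
      ?_ (fun n => ?_) R
    · have h1 : Measurable fun q : Space3 × Sphere2 => (q.1, directionApprox k q.2) :=
        measurable_fst.prodMk ((directionApprox k).measurable.comp measurable_snd)
      exact measurableSet_le ((hf (s i)).sub ((hf (s i)).comp h1)).abs
        ((hωm k).comp measurable_snd)
    · filter_upwards [hfσ (s i) n (directionApprox k n)] with y hy
      rwa [← hτσ] at hy
  have hωm' : ∀ k, AEStronglyMeasurable (fun p : Sphere2 × ℝ => ω k p.1) (rayMeasure R) := fun k =>
    ((hωm k).comp measurable_fst).aestronglyMeasurable
  refine eventually_integral_sq_rayAverage_sub_lt (fun j => hf (s j)) (fun j => hg (s j))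
    (fun j => hfM (s j)) (fun j => hgM (s j)) hb (fun j => hgb (s j)) (s := directionApprox)
    (fun k n => ?_) (hw 0) R (ω := fun k p => ω k p.1)
    (fun k => Integrable.of_bound (hωm' k) C (Eventually.of_forall fun p => hωC k _))
    ?_ hμ hfω hε
  · rw [hind]
    exact hw (ind k n + 1)
  -- Pointwise convergence in `n` with the bound `C` suffices; no uniformity in the direction is
  -- required.
  · have := tendsto_integral_of_dominated_convergence (μ := rayMeasure R)
      (F := fun k p => ω k p.1) (f := fun _ => (0 : ℝ)) (fun _ => C) hωm' (integrable_const _)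
      (fun k => Eventually.of_forall fun p => hωC k _) (Eventually.of_forall fun p => hω0 p.1)
    simpa using this

/-! ### Total boundedness and the conclusion -/

/-- If total boundedness fails, points of the range can be chosen greedily at mutual distance at
least `ε`. The resulting `k` has no Cauchy subsequence. -/
theorem totallyBounded_range_of_subseq_cauchy {X : Type*} [PseudoMetricSpace X] {u : ℕ → X}
    (h : ∀ k : ℕ → ℕ, ∃ s : ℕ → ℕ, StrictMono s ∧ ∀ ε > 0, ∀ᶠ q : ℕ × ℕ in atTop,
      dist (u (k (s q.1))) (u (k (s q.2))) < ε) :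
    TotallyBounded (range u) := by
  by_contra hcon
  rw [Metric.totallyBounded_iff] at hcon
  push Not at hcon
  obtain ⟨ε, hε, H⟩ := hcon
  obtain ⟨k, -, hk⟩ := exists_seq_of_forall_finset_exists (fun _ : ℕ => True)
    (fun m n => ε ≤ dist (u n) (u m)) (fun t _ => by
      have h1 := H _ ((t : Set ℕ).toFinite.image u)
      obtain ⟨_, ⟨n, rfl⟩, hn⟩ := not_subset.1 h1
      refine ⟨n, trivial, fun m hm => ?_⟩
      by_contra hlt
      exact hn (mem_biUnion (mem_image_of_mem u hm) (not_le.1 hlt)))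
  obtain ⟨s, hs, H⟩ := h k
  obtain ⟨⟨N₁, N₂⟩, hN⟩ := eventually_atTop.1 (H ε hε)
  have h1 := hN (max N₁ N₂, max N₁ N₂ + 1)
    ⟨le_max_left _ _, (le_max_right _ _).trans (Nat.le_succ _)⟩
  have h2 := hk _ _ (hs (Nat.lt_succ_self (max N₁ N₂)))
  rw [dist_comm] at h2
  exact absurd h1 (not_lt.2 h2)

theorem dist_toLp_sq {μ : Measure Space3} {U V : Space3 → ℝ} (hU : MemLp U 2 μ)
    (hV : MemLp V 2 μ) : dist (hU.toLp U) (hV.toLp V) ^ 2 = ∫ x, (U x - V x) ^ 2 ∂μ := by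
  rw [dist_eq_norm, ← MemLp.toLp_sub, ← real_inner_self_eq_norm_sq, L2.inner_def]
  refine integral_congr_ae ?_
  filter_upwards [(hU.sub hV).coeFn_toLp] with x hx
  rw [hx]
  simp [sq]

theorem mainTheorem9 (Ω : Set Space3) (hΩo : IsOpen Ω) (hΩb : Bornology.IsBounded Ω)
    (φ : ℕ → C(Sphere2, LpOn ∞ Ω)) (ψ : ℕ → LpOn ∞ Ω)
    (hφ : ∃ M : ℝ, ∀ (j : ℕ) (n : Sphere2), ‖φ j n‖ ≤ M)
    (σ : ℝ → ℝ) (hσc : ContinuousOn σ (Set.Ici 0)) (hσ_nonneg : ∀ t : ℝ, 0 ≤ t → 0 ≤ σ t)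
    (hσ0 : σ 0 = 0)
    (hφσ : ∀ (j : ℕ) (n₁ n₂ : Sphere2),
      ‖φ j n₁ - φ j n₂‖ ≤ σ (InnerProductGeometry.angle (n₁ : Space3) (n₂ : Space3)))
    (hψ : ∃ M : ℝ, ∀ j : ℕ, ‖ψ j‖ ≤ M) :
    (∀ j : ℕ, ∃ f : Space3 → Sphere2 → ℝ, IsMeasurableVersion Ω (φ j) f) ∧
    ∀ f : ℕ → Space3 → Sphere2 → ℝ, (∀ j : ℕ, IsMeasurableVersion Ω (φ j) (f j)) →
      (∀ j : ℕ, ∀ᵐ x : Space3 ∂(volume.restrict Ω), AttenuatedIntegrable Ω (f j) (ψ j) x) ∧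
      ∃ u : ℕ → LpOn 2 Ω,
        (∀ j : ℕ, u j =ᵐ[volume.restrict Ω] attenuatedLineIntegral Ω (f j) (ψ j)) ∧
        IsCompact (closure (Set.range u)) := by
  refine ⟨fun j => exists_isMeasurableVersion Ω (φ j), fun f hf => ?_⟩
  have hΩ : MeasurableSet Ω := hΩo.measurableSet
  have hΩfin : IsFiniteMeasure (volume.restrict Ω) :=
    isFiniteMeasure_restrict.2 hΩb.measure_lt_top.ne
  obtain ⟨M₁, hM₁⟩ := hφ
  obtain ⟨M₂, hM₂⟩ := hψ
  set M := max M₁ M₂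
  have hM : 0 ≤ M := (norm_nonneg _).trans ((hM₂ 0).trans (le_max_right _ _))
  -- Truncating at the norm bound changes each function only on a null set of `Ω`, and makes the
  -- bounds valid at every point.
  set F : ℕ → Space3 → Sphere2 → ℝ := fun j y n => truncate Ω M (fun y => f j y n) y with hF
  set G : ℕ → Space3 → ℝ := fun j => truncate Ω M (ψ j) with hG
  set R := Metric.diam Ω
  have hFm : ∀ j, Measurable fun q : Space3 × Sphere2 => F j q.1 q.2 := fun j =>
    measurable_truncate_uncurry hΩ M (hf j).1
  have hGm : ∀ j, Measurable (G j) := fun j =>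
    measurable_truncate hΩ M (Lp.stronglyMeasurable (ψ j)).measurable
  have hFM : ∀ j y n, |F j y n| ≤ M := fun j y n => abs_truncate_le Ω hM _ y
  have hGM : ∀ j y, |G j y| ≤ M := fun j y => abs_truncate_le Ω hM _ y
  have hfF : ∀ j n, ∀ᵐ y, F j y n = Ω.indicator (fun y => f j y n) y := fun j n => by
    refine ae_truncate_eq hΩ ?_
    filter_upwards [(hf j).2 n, ae_abs_coeFn_le_norm (φ j n)] with y h1 h2
    rw [h1]
    exact h2.trans ((hM₁ j n).trans (le_max_left _ _))
  have hgG : ∀ j, ∀ᵐ y, G j y = Ω.indicator (ψ j) y := fun j => by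
    refine ae_truncate_eq hΩ ?_
    filter_upwards [ae_abs_coeFn_le_norm (ψ j)] with y h
    exact h.trans ((hM₂ j).trans (le_max_right _ _))
  have hFσ : ∀ j n₁ n₂, ∀ᵐ y, |F j y n₁ - F j y n₂| ≤
      σ (InnerProductGeometry.angle (n₁ : Space3) (n₂ : Space3)) := fun j n₁ n₂ => by
    filter_upwards [hfF j n₁, hfF j n₂, (ae_restrict_iff' hΩ).1 ((hf j).2 n₁),
      (ae_restrict_iff' hΩ).1 ((hf j).2 n₂),
      (ae_restrict_iff' hΩ).1 (ae_abs_sub_le_norm_sub (φ j n₁) (φ j n₂))] with y h1 h2 h3 h4 h5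
    rw [h1, h2]
    by_cases hy : y ∈ Ω
    · rw [indicator_of_mem hy, indicator_of_mem hy, h3 hy, h4 hy]
      exact (h5 hy).trans (hφσ j n₁ n₂)
    · simpa [hy] using hσ_nonneg _ (InnerProductGeometry.angle_nonneg _ _)
  have hmain : ∀ j, ∀ᵐ x, AttenuatedIntegrable Ω (f j) (ψ j) x ∧
      attenuatedLineIntegral Ω (f j) (ψ j) x = rayAverage R (F j) (G j) x := fun j =>
    ae_attenuatedLineIntegral_eq hΩ (hf j).1 (hFm j) (hGm j) (hFM j) (hGM j) (hfF j) (hgG j)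
  have hU : ∀ j, MemLp (rayAverage R (F j) (G j)) 2 (volume.restrict Ω) := fun j =>
    MemLp.of_bound (measurable_rayAverage R (hFm j) (hGm j)).aestronglyMeasurable _
      (Eventually.of_forall (abs_rayAverage_le (hFM j) (hGM j) R))
  have hb : Integrable (Ω.indicator fun _ => M) :=
    (integrable_indicator_iff hΩ).2 (integrable_const M)
  refine ⟨fun j => (ae_restrict_of_ae (hmain j)).mono fun x hx => hx.1,
    fun j => (hU j).toLp _, fun j => ?_, ?_⟩
  · filter_upwards [(hU j).coeFn_toLp, ae_restrict_of_ae (hmain j)] with x h1 h2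
    rw [h1, h2.2]
  · refine TotallyBounded.isCompact_of_isClosed (TotallyBounded.closure ?_) isClosed_closure
    -- All hypotheses are uniform in `j`, so the extraction applies to the sequences reindexed by an
    -- arbitrary `k`.
    refine totallyBounded_range_of_subseq_cauchy fun k => ?_
    obtain ⟨s, hs, H⟩ := exists_subseq_eventually_integral_sq_lt (fun j => hFm (k j))
      (fun j => hGm (k j)) (fun j => hFM (k j)) (fun j => hGM (k j)) hb
      (fun j => abs_truncate_le_indicator Ω hM (ψ (k j))) hσc hσ0 (fun j => hFσ (k j)) R
      (Measure.restrict_le_self (s := Ω))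
    refine ⟨s, hs, fun ε hε => ?_⟩
    filter_upwards [H (ε ^ 2) (by positivity)] with q hq
    rw [← dist_toLp_sq (hU _) (hU _)] at hq
    exact lt_of_pow_lt_pow_left₀ 2 hε.le hq
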